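/- Let $L$ be a frame. An $L$-subset of $X$ is a map $A:X\to L$, and $\mathrm{sub}(A,B)=\bigwedge_{x}A(x)\to B(x)$. An $L$-ordered set is a set $P$ with a map $e:P\times P\to L$ such that $e(x,x)=1$, $e(x,y)\wedge e(y,z)\le e(x,z)$, and $e(x,y)\wedge e(y,x)=1$ implies $x=y$. An element $x$ is the supremum $\sqcup A$ of $A\in L^P$ if $e(x,y)=\mathrm{sub}(A,e(-,y))$ for all $y$. An $L$-subset $D\in L^P$ is directed if $\bigvee_x D(x)=1$ and $D(x)\wedge D(y)\le\bigvee_z D(z)\wedge e(x,z)\wedge e(y,z)$ for all $x,y$. $P$ is an $L$-dcpo if all directed $L$-subsets have suprema. Let $\mathcal D^*(P)$ be the set of directed $L$-subsets of $P$ that have a supremum. $P$ is continuous if for every $x$ the $L$-subset $\Downarrow x$, $\Downarrow x(y)=\bigwedge_{D\in\mathcal D^*(P)}\bigl(e(x,\sqcup D)\to\bigvee_d D(d)\wedge e(y,d)\bigr)$, is directed with supremum $x$. A map $f:P\to Q$ of $L$-ordered sets is Scott continuous if for every $D\in\mathcal D^*(P)$ the $L$-subset $f^\to(D)$, $f^{\to}(D)(q)=\bigvee_{f(x)=q}D(x)$,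 has supremum $f(\sqcup D)$. An $L$-topology on $X$ is a family $\mathcal O(X)\subseteq L^X$ closed under binary meets and arbitrary joins and containing all constant maps; $f:X\to Y$ is continuous if $B\circ f\in\mathcal O(X)$ for all $B\in\mathcal O(Y)$. $X$ is $T_0$ if $A(x)=A(y)$ for all $A\in\mathcal O(X)$ implies $x=y$. A point of $\mathcal O(X)$ is a map $p:\mathcal O(X)\to L$ that preserves binary meets and arbitrary joins and sends the constant map with value $a$ to $a$ for every $a\in L$. $X$ is $L$-sober if $x\mapsto[x]$, $[x](A)=A(x)$, is a bijection from $X$ onto the set of points of $\mathcal O(X)$; $L$-sober spaces are $T_0$. $X$ is locally super-compact if every $A\in\mathcal O(X)$ equals $\bigvee_B \mathrm{sub}(B,A)\wedge B^\circ$, where $B^\circ$ is the largest open $L$-subset below $B$ and $B$ runs over the $L$-subsets with $\bigvee_x B(x)=1$ and $\mathrm{sub}(B,\bigvee_i V_i)=\bigvee_i\mathrm{sub}(B,V_i)$ for all families $(V_i)$ of open sets. For an $L$-ordered set $P$, let $\Sigma_LP=(P,\sigma_L(P))$, where $\sigma_L(P)$ consists of the $A\in L^P$ with $A(x)\wedge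 e(x,y)\le A(y)$ for all $x,y$ and $A(\sqcup D)=\bigvee_x A(x)\wedge D(x)$ for all $D\in\mathcal D^*(P)$. For a $T_0$ space $X$, let $\Omega_LX$ be $X$ with the $L$-order $e(x,y)=\bigwedge_{A\in\mathcal O(X)}A(x)\to A(y)$. On maps, put $\Sigma_Lf=f$ and $\Omega_Lf=f$. Let $P$ be a continuous $L$-ordered set. A directed completion of $P$ is a continuous $L$-dcpo $Q$ for which there is a Scott continuous map $j:P\to Q$ such that every Scott continuous map $f$ from $P$ to a continuous $L$-dcpo $M$ is $f=\bar f\circ j$ for a unique Scott continuous $\bar f:Q\to M$. An $L$-sobrification of $\Sigma_LP$ is an $L$-sober space $Y$ for which there is a continuous map $j:\Sigma_LP\to Y$ such that every continuous map $f$ from $\Sigma_LP$ to an $L$-sober space $Z$ is $f=\bar f\circ j$ for a unique continuous $\bar f:Y\to Z$. Let $\mathbf D_L(P)$ be the category of directed completions of $P$ with all Scott continuous maps between them, and $\mathbf S_L(P)$ the category of $L$-sobrifications of $\Sigma_LP$ with all continuous maps between them. Then every object of $\mathbf S_L(P)$ is locally super-compact, and $\Sigma_L$ and $\Omega_L$ restrict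 to functors $\Sigma_L:\mathbf D_L(P)\to\mathbf S_L(P)$ and $\Omega_L:\mathbf S_L(P)\to\mathbf D_L(P)$ which are mutually inverse, i.e. $\Omega_L\circ\Sigma_L=\mathrm{id}_{\mathbf D_L(P)}$ and $\Sigma_L\circ\Omega_L=\mathrm{id}_{\mathbf S_L(P)}$. Hence $\mathbf D_L(P)$ and $\mathbf S_L(P)$ are isomorphic categories. -/

import Mathlib

open CategoryTheory

universe u v w

/-! ### `L`-subsets

Throughout, `L` is a frame and an `L`-subset of `X` is a map `X → L`. -/

section LSubsets

variable {L : Type u} [Order.Frame L] {X : Type v} {Y : Type w}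

/-- The inclusion degree `sub(A, B) = ⋀ₓ A(x) → B(x)` of two `L`-subsets. -/
def lsub (A B : X → L) : L := ⨅ x, A x ⇨ B x

/-- The forward Zadeh extension `f^→ : L^X → L^Y`. -/
def zadehImage (f : X → Y) (A : X → L) : Y → L := fun y => ⨆ (x : X) (_ : f x = y), A x

end LSubsets

/-! ### `L`-ordered sets -/

/-- An `L`-order on `P`. -/
@[ext]
structure LOrder (L : Type u) [Order.Frame L] (P : Type v) where
  /-- the degree to which `x` is below `y` -/
  rel : P → P → L
  rel_refl : ∀ x, rel x x = ⊤
  rel_trans : ∀ x y z, rel x y ⊓ rel y z ≤ rel x z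
  rel_antisymm : ∀ x y, rel x y ⊓ rel y x = ⊤ → x = y

namespace LOrder

variable {L : Type u} [Order.Frame L] {P : Type v} (e : LOrder L P)

/-- `↓y`, the `L`-subset `x ↦ e(x, y)`. -/
def lower (y : P) : P → L := fun x => e.rel x y

/-- `x` is a supremum of the `L`-subset `A`: `e(x, y) = sub(A, ↓y)` for all `y`. -/
def IsSup (A : P → L) (x : P) : Prop := ∀ y, e.rel x y = lsub A (e.lower y)

/-- Directed `L`-subsets (nonemptiness is included). -/
def IsDirected (D : P → L) : Prop :=
  (⨆ x, D x) = ⊤ ∧ ∀ x y, D x ⊓ D y ≤ ⨆ z, D z ⊓ e.rel x z ⊓ e.rel y z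

/-- An `L`-dcpo: every directed `L`-subset has a supremum. -/
def IsDcpo : Prop := ∀ D : P → L, e.IsDirected D → ∃ x, e.IsSup D x

/-- `e.wayBelow x y` is the value `(⇓x)(y)`; the infimum runs over all directed `L`-subsets `D`
that have a supremum `s`. -/
def wayBelow (x : P) : P → L := fun y =>
  ⨅ (D : P → L) (s : P) (_ : e.IsDirected D) (_ : e.IsSup D s),
    e.rel x s ⇨ ⨆ d, D d ⊓ e.rel y d

/-- Continuous `L`-ordered sets (not necessarily `L`-dcpos). -/
def IsContinuous : Prop := ∀ x, e.IsDirected (e.wayBelow x) ∧ e.IsSup (e.wayBelow x) x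

/-- Scott continuous maps: suprema of directed `L`-subsets, where they exist, are preserved. -/
def ScottContinuous {Q : Type w} (e : LOrder L P) (e' : LOrder L Q) (f : P → Q) : Prop :=
  ∀ (D : P → L) (s : P), e.IsDirected D → e.IsSup D s → e'.IsSup (zadehImage f D) (f s)

/-- `L`-order-preserving maps. -/
def OrderPreserving {Q : Type w} (e : LOrder L P) (e' : LOrder L Q) (f : P → Q) : Prop :=
  ∀ x y, e.rel x y ≤ e'.rel (f x) (f y)

/-- Scott open `L`-subsets: upper sets `A` with `A(⊔D) = ⋁ₓ A(x) ∧ D(x)` for every directed `D`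
that has a supremum. -/
def IsScottOpen (A : P → L) : Prop :=
  (∀ x y, A x ⊓ e.rel x y ≤ A y) ∧
    ∀ (D : P → L) (s : P), e.IsDirected D → e.IsSup D s → A s = ⨆ x, A x ⊓ D x

end LOrder

/-! ### `L`-topological spaces -/

/-- A (stratified) `L`-topology on `X`. -/
@[ext]
structure LTopology (L : Type u) [Order.Frame L] (X : Type v) where
  /-- the family of open `L`-subsets -/
  opens : Set (X → L)
  inf_mem : ∀ {A B}, A ∈ opens → B ∈ opens → A ⊓ B ∈ opens
  sSup_mem : ∀ {S : Set (X → L)}, S ⊆ opens → sSup S ∈ opens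
  const_mem : ∀ a : L, (fun _ => a) ∈ opens

namespace LTopology

variable {L : Type u} [Order.Frame L] {X : Type v} (τ : LTopology L X)

/-- Continuous maps: preimages of open `L`-subsets are open. -/
def ContinuousMap {Y : Type w} (τ : LTopology L X) (τ' : LTopology L Y) (f : X → Y) : Prop :=
  ∀ B ∈ τ'.opens, B ∘ f ∈ τ.opens

/-- The `T₀` axiom. -/
def IsT0 : Prop := ∀ x y, (∀ A ∈ τ.opens, A x = A y) → x = y

/-- The interior of an `L`-subset. -/
def interior (A : X → L) : X → L := sSup {B | B ∈ τ.opens ∧ B ≤ A}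

/-- Points of the `L`-frame of open sets. -/
structure Point where
  /-- the underlying map `𝒪(X) → L` -/
  toFun : τ.opens → L
  map_inf : ∀ A B : τ.opens, toFun ⟨A.1 ⊓ B.1, τ.inf_mem A.2 B.2⟩ = toFun A ⊓ toFun B
  map_sSup : ∀ (S : Set (X → L)) (hS : S ⊆ τ.opens),
    toFun ⟨sSup S, τ.sSup_mem hS⟩ = ⨆ A : S, toFun ⟨A.1, hS A.2⟩
  map_const : ∀ a : L, toFun ⟨fun _ => a, τ.const_mem a⟩ = a

/-- The point `[x]`, evaluation of open `L`-subsets at `x`. -/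
def evalPoint (x : X) : τ.Point where
  toFun A := A.1 x
  map_inf _ _ := rfl
  map_sSup _ _ := sSup_apply
  map_const _ := rfl

/-- `L`-sobriety: `x ↦ [x]` is a bijection onto the points of `𝒪(X)`. -/
def IsSober : Prop := Function.Bijective τ.evalPoint

/-- Super-compact `L`-subsets. -/
def IsSuperCompact (A : X → L) : Prop :=
  (⨆ x, A x) = ⊤ ∧ ∀ S : Set (X → L), S ⊆ τ.opens → lsub A (sSup S) = ⨆ V : S, lsub A V.1

/-- Locally super-compact `L`-topological spaces. -/
def IsLocallySuperCompact : Prop :=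
  ∀ A ∈ τ.opens, ∀ x, A x = ⨆ (B : X → L) (_ : τ.IsSuperCompact B), lsub B A ⊓ τ.interior B x

theorem IsSober.isT0 {τ : LTopology L X} (h : τ.IsSober) : τ.IsT0 := by
  intro x y hxy
  apply h.1
  have : (fun A : τ.opens => A.1 x) = fun A : τ.opens => A.1 y := funext fun A => hxy A.1 A.2
  simp only [evalPoint, this]

/-- The specialization `L`-order of a `T₀` space: `e(x, y) = ⋀ A(x) → A(y)` over open `A`. -/
def specializationOrder (h : τ.IsT0) : LOrder L X where
  rel x y := ⨅ A : τ.opens, A.1 x ⇨ A.1 y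
  rel_refl x := by simp
  rel_trans x y z := le_iInf fun A =>
    (inf_le_inf (iInf_le _ A) (iInf_le _ A)).trans (himp_triangle _ _ _)
  rel_antisymm x y hxy := by
    rw [inf_eq_top_iff] at hxy
    refine h x y fun A hA => le_antisymm ?_ ?_
    · exact himp_eq_top_iff.1 (top_le_iff.1 (hxy.1 ▸ iInf_le (fun A : τ.opens => A.1 x ⇨ A.1 y) ⟨A, hA⟩))
    · exact himp_eq_top_iff.1 (top_le_iff.1 (hxy.2 ▸ iInf_le (fun A : τ.opens => A.1 y ⇨ A.1 x) ⟨A, hA⟩))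

end LTopology

/-! ### The Scott `L`-topology -/

namespace LOrder

variable {L : Type u} [Order.Frame L] {P : Type v}

/-- The Scott `L`-topology `σ_L(P)`. -/
def scottTopology (e : LOrder L P) : LTopology L P where
  opens := {A | e.IsScottOpen A}
  inf_mem := by
    rintro A B ⟨hA, hA'⟩ ⟨hB, hB'⟩
    refine ⟨fun x y => le_inf ((inf_le_inf_right _ inf_le_left).trans (hA x y))
      ((inf_le_inf_right _ inf_le_right).trans (hB x y)), fun D s hD hs => le_antisymm ?_ ?_⟩
    · rw [Pi.inf_apply, hA' D s hD hs, hB' D s hD hs, iSup_inf_iSup]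
      refine iSup_le fun ⟨x, y⟩ => ?_
      calc A x ⊓ D x ⊓ (B y ⊓ D y) = (A x ⊓ B y) ⊓ (D x ⊓ D y) := inf_inf_inf_comm _ _ _ _
        _ ≤ (A x ⊓ B y) ⊓ ⨆ z, D z ⊓ e.rel x z ⊓ e.rel y z := inf_le_inf_left _ (hD.2 x y)
        _ = ⨆ z, (A x ⊓ B y) ⊓ (D z ⊓ e.rel x z ⊓ e.rel y z) := inf_iSup_eq _ _
        _ ≤ ⨆ z, (A ⊓ B) z ⊓ D z := iSup_mono fun z => by
          refine le_inf (le_inf (le_trans (le_inf ?_ ?_) (hA x z))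
            (le_trans (le_inf ?_ ?_) (hB y z))) ?_
          · exact inf_le_left.trans inf_le_left
          · exact inf_le_right.trans (inf_le_left.trans inf_le_right)
          · exact inf_le_left.trans inf_le_right
          · exact inf_le_right.trans inf_le_right
          · exact inf_le_right.trans (inf_le_left.trans inf_le_left)
    · refine iSup_le fun x => le_inf ?_ ?_
      · rw [hA' D s hD hs]
        exact (inf_le_inf_right _ inf_le_left).trans (le_iSup (fun x => A x ⊓ D x) x)
      · rw [hB' D s hD hs]
        exact (inf_le_inf_right _ inf_le_right).trans (le_iSup (fun x => B x ⊓ D x) x)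
  sSup_mem := by
    intro S hS
    refine ⟨fun x y => ?_, fun D s hD hs => ?_⟩
    · rw [sSup_apply, sSup_apply, iSup_inf_eq]
      exact iSup_mono fun A => (hS A.2).1 x y
    · simp only [sSup_apply, iSup_inf_eq]
      rw [iSup_comm]
      exact iSup_congr fun A => (hS A.2).2 D s hD hs
  const_mem a := ⟨fun _ _ => inf_le_left, fun D s hD _ => by
    rw [← inf_iSup_eq, hD.1, inf_top_eq]⟩

variable {Q : Type v} {R : Type v} {e : LOrder L P} {e' : LOrder L Q} {e'' : LOrder L R}

theorem ScottContinuous.orderPreserving {f : P → Q} (hf : e.ScottContinuous e' f) :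
    e.OrderPreserving e' f := by
  intro x y
  have hd : e.IsDirected (e.lower y) := by
    refine ⟨top_le_iff.1 ?_, fun a b => ?_⟩
    · rw [← e.rel_refl y]
      exact le_iSup (e.lower y) y
    · refine le_trans ?_ (le_iSup _ y)
      simp [lower, e.rel_refl]
  have hs : e.IsSup (e.lower y) y := by
    intro z
    refine le_antisymm (le_iInf fun a => le_himp_iff.2 ?_) ?_
    · rw [inf_comm]
      exact e.rel_trans a y z
    · refine (iInf_le _ y).trans ?_
      simp [lower, e.rel_refl]
  have h1 : lsub (zadehImage f (e.lower y)) (e'.lower (f y)) = ⊤ := by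
    rw [← hf _ _ hd hs, e'.rel_refl]
  have h2 := iInf_le (fun q => zadehImage f (e.lower y) q ⇨ e'.lower (f y) q) (f x)
  change lsub _ _ ≤ _ at h2
  rw [h1, top_le_iff, himp_eq_top_iff] at h2
  exact le_trans (le_iSup₂_of_le (f := fun a (_ : f a = f x) => e.lower y a) x rfl le_rfl) h2

theorem OrderPreserving.isDirected {f : P → Q} (hf : e.OrderPreserving e' f) {D : P → L}
    (hD : e.IsDirected D) : e'.IsDirected (zadehImage f D) := by
  have key : ∀ x, D x ≤ zadehImage f D (f x) := fun x =>
    le_iSup₂_of_le (f := fun a (_ : f a = f x) => D a) x rfl le_rfl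
  refine ⟨top_le_iff.1 ?_, fun a b => ?_⟩
  · rw [← hD.1]
    exact iSup_le fun x => (key x).trans (le_iSup (zadehImage f D) (f x))
  · simp only [zadehImage, iSup_inf_eq, inf_iSup_eq]
    refine iSup_le fun y => iSup_le fun hy => iSup_le fun x => iSup_le fun hx => ?_
    subst hx hy
    refine (hD.2 _ _).trans (iSup_le fun z => ?_)
    refine le_iSup_of_le (f z) (le_iSup₂_of_le z rfl ?_)
    exact inf_le_inf (inf_le_inf le_rfl (hf _ _)) (hf _ _)

theorem ScottContinuous.id (e : LOrder L P) : e.ScottContinuous e _root_.id := by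
  intro D s _ hs
  have : zadehImage _root_.id D = D := by
    funext y
    simp [zadehImage]
  rw [this]
  exact hs

theorem ScottContinuous.comp {g : Q → R} {f : P → Q} (hg : e'.ScottContinuous e'' g)
    (hf : e.ScottContinuous e' f) : e.ScottContinuous e'' (g ∘ f) := by
  intro D s hD hs
  have : zadehImage (g ∘ f) D = zadehImage g (zadehImage f D) := by
    funext y
    refine le_antisymm (iSup₂_le fun x hx => ?_) (iSup₂_le fun z hz => iSup₂_le fun x hx => ?_)
    · exact le_iSup₂_of_le (f x) hx (le_iSup₂_of_le x rfl le_rfl)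
    · subst hx
      exact le_iSup₂_of_le x hz le_rfl
  rw [this]
  exact hg _ _ (hf.orderPreserving.isDirected hD) (hf D s hD hs)

theorem ScottContinuous.continuousMap {f : P → Q} (hf : e.ScottContinuous e' f) :
    e.scottTopology.ContinuousMap e'.scottTopology f := by
  rintro B ⟨hB, hB'⟩
  refine ⟨fun x y => (inf_le_inf_left _ (hf.orderPreserving x y)).trans (hB _ _), ?_⟩
  intro D s hD hs
  change B (f s) = _
  rw [hB' _ _ (hf.orderPreserving.isDirected hD) (hf D s hD hs)]
  refine le_antisymm (iSup_le fun y => ?_) (iSup_le fun x => ?_)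
  · simp only [zadehImage, inf_iSup_eq]
    refine iSup₂_le fun x hx => ?_
    subst hx
    exact le_iSup (fun x => (B ∘ f) x ⊓ D x) x
  · exact le_iSup_of_le (f x) (inf_le_inf_left _
      (le_iSup₂_of_le (f := fun a (_ : f a = f x) => D a) x rfl le_rfl))

end LOrder

theorem LTopology.ContinuousMap.orderPreserving {L : Type u} [Order.Frame L] {X : Type v}
    {Y : Type w} {τ : LTopology L X} {τ' : LTopology L Y} {f : X → Y}
    (hf : τ.ContinuousMap τ' f) (h : τ.IsT0) (h' : τ'.IsT0) :
    (τ.specializationOrder h).OrderPreserving (τ'.specializationOrder h') f := fun x y =>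
  le_iInf fun B => iInf_le (fun A : τ.opens => A.1 x ⇨ A.1 y) ⟨B.1 ∘ f, hf B.1 B.2⟩

/-! ### The categories and the functors `Σ_L` and `Ω_L` -/

/-- `L`-ordered sets, as objects of the category with Scott continuous maps. -/
structure LPosScott (L : Type u) [Order.Frame L] where
  /-- the underlying set -/
  carrier : Type w
  /-- the `L`-order -/
  order : LOrder L carrier

/-- `L`-ordered sets, as objects of the category with `L`-order-preserving maps. -/
structure LPosMono (L : Type u) [Order.Frame L] where
  /-- the underlying set -/
  carrier : Type w
  /-- the `L`-order -/
  order : LOrder L carrier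

/-- `L`-topological spaces. -/
structure LTopCat (L : Type u) [Order.Frame L] where
  /-- the underlying set -/
  carrier : Type w
  /-- the `L`-topology -/
  topology : LTopology L carrier

section Categories

variable (L : Type u) [Order.Frame L]

/-- Scott continuous maps. -/
@[ext]
structure LPosScott.Hom (P Q : LPosScott.{u, w} L) where
  /-- the underlying map -/
  toFun : P.carrier → Q.carrier
  prop : P.order.ScottContinuous Q.order toFun

instance : Category.{w} (LPosScott.{u, w} L) where
  Hom := LPosScott.Hom L
  id P := ⟨_root_.id, LOrder.ScottContinuous.id P.order⟩
  comp f g := ⟨g.toFun ∘ f.toFun, g.prop.comp f.prop⟩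

/-- `L`-order-preserving maps. -/
@[ext]
structure LPosMono.Hom (P Q : LPosMono.{u, w} L) where
  /-- the underlying map -/
  toFun : P.carrier → Q.carrier
  prop : P.order.OrderPreserving Q.order toFun

instance : Category.{w} (LPosMono.{u, w} L) where
  Hom := LPosMono.Hom L
  id P := ⟨_root_.id, fun _ _ => le_rfl⟩
  comp f g := ⟨g.toFun ∘ f.toFun, fun x y => (f.prop x y).trans (g.prop _ _)⟩

/-- Continuous maps. -/
@[ext]
structure LTopCat.Hom (X Y : LTopCat.{u, w} L) where
  /-- the underlying map -/
  toFun : X.carrier → Y.carrier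
  prop : X.topology.ContinuousMap Y.topology toFun

instance : Category.{w} (LTopCat.{u, w} L) where
  Hom := LTopCat.Hom L
  id X := ⟨_root_.id, fun _ hB => hB⟩
  comp f g := ⟨g.toFun ∘ f.toFun, fun B hB => f.prop _ (g.prop B hB)⟩

/-- Every Scott continuous map is `L`-order-preserving. -/
def LPosScott.toMono : LPosScott.{u, w} L ⥤ LPosMono.{u, w} L where
  obj P := ⟨P.carrier, P.order⟩
  map f := ⟨f.toFun, f.prop.orderPreserving⟩

/-- The category of continuous `L`-dcpos and Scott continuous maps. -/
abbrev CDom :=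
  ObjectProperty.FullSubcategory
    (fun P : LPosScott.{u, w} L => P.order.IsContinuous ∧ P.order.IsDcpo)

/-- The category of `T₀` `L`-topological spaces and continuous maps. -/
abbrev LTopT0 :=
  ObjectProperty.FullSubcategory (fun X : LTopCat.{u, w} L => X.topology.IsT0)

/-- The category of `L`-sober spaces and continuous maps. -/
abbrev LSob :=
  ObjectProperty.FullSubcategory (fun X : LTopCat.{u, w} L => X.topology.IsSober)

/-- The inclusion of continuous `L`-dcpos into `L`-ordered sets. -/
abbrev CDom.incl : CDom.{u, w} L ⥤ LPosScott.{u, w} L := ObjectProperty.ι _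

/-- The inclusion of `L`-sober spaces into `L`-topological spaces. -/
abbrev LSob.incl : LSob.{u, w} L ⥤ LTopCat.{u, w} L := ObjectProperty.ι _

/-- The inclusion of `L`-sober spaces into `T₀` `L`-topological spaces. -/
abbrev LSob.toT0 : LSob.{u, w} L ⥤ LTopT0.{u, w} L :=
  ObjectProperty.ιOfLE fun _ h => h.isT0

/-- The functor `Σ_L`: it sends `P` to its Scott space and `f` to `f`. -/
def sigmaL : LPosScott.{u, w} L ⥤ LTopCat.{u, w} L where
  obj P := ⟨P.carrier, P.order.scottTopology⟩
  map f := ⟨f.toFun, f.prop.continuousMap⟩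

/-- The functor `Ω_L`: it sends a `T₀` space to its set of points with the specialization
`L`-order and `f` to `f`. -/
def omegaL : LTopT0.{u, w} L ⥤ LPosMono.{u, w} L where
  obj X := ⟨X.obj.carrier, X.obj.topology.specializationOrder X.property⟩
  map {X Y} f := ⟨f.hom.toFun, f.hom.prop.orderPreserving X.property Y.property⟩

end Categories

/-! ### Directed completions and `L`-sobrifications -/

section Completions

variable {L : Type u} [Order.Frame L] {P : Type v}

/-- `Q` is a directed completion of `(P, e)`: some Scott continuous `j : P → Q` is universal among
Scott continuous maps from `P` to continuous `L`-dcpos. -/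
def IsDirectedCompletion (e : LOrder L P) (Q : CDom.{u, w} L) : Prop :=
  ∃ j : P → Q.obj.carrier, e.ScottContinuous Q.obj.order j ∧
    ∀ (M : CDom.{u, w} L) (f : P → M.obj.carrier), e.ScottContinuous M.obj.order f →
      ∃! g : Q.obj.carrier → M.obj.carrier,
        Q.obj.order.ScottContinuous M.obj.order g ∧ g ∘ j = f

/-- `Y` is an `L`-sobrification of `(P, τ)`: some continuous `j : P → Y` is universal among
continuous maps from `P` to `L`-sober spaces. -/
def IsLSobrification (τ : LTopology L P) (Y : LSob.{u, w} L) : Prop :=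
  ∃ j : P → Y.obj.carrier, τ.ContinuousMap Y.obj.topology j ∧
    ∀ (Z : LSob.{u, w} L) (f : P → Z.obj.carrier), τ.ContinuousMap Z.obj.topology f →
      ∃! g : Y.obj.carrier → Z.obj.carrier,
        Y.obj.topology.ContinuousMap Z.obj.topology g ∧ g ∘ j = f

/-- The category of directed completions of `(P, e)`, with all Scott continuous maps as
morphisms. Its objects live in a universe large enough to contain the points of `σ_L(P)`. -/
abbrev DirectedCompletions (e : LOrder L P) :=
  ObjectProperty.FullSubcategory (fun Q : CDom.{u, max u v} L => IsDirectedCompletion e Q)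

/-- The category of `L`-sobrifications of `(P, τ)`, with all continuous maps as morphisms. -/
abbrev LSobrifications (τ : LTopology L P) :=
  ObjectProperty.FullSubcategory (fun Y : LSob.{u, max u v} L => IsLSobrification τ Y)

/-- The inclusion of directed completions into continuous `L`-dcpos. -/
abbrev DirectedCompletions.incl (e : LOrder L P) :
    DirectedCompletions e ⥤ CDom.{u, max u v} L := ObjectProperty.ι _

/-- The inclusion of `L`-sobrifications into `L`-sober spaces. -/
abbrev LSobrifications.incl (τ : LTopology L P) :
    LSobrifications τ ⥤ LSob.{u, max u v} L := ObjectProperty.ι _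

end Completions

/-!
A sobrification of `Σ_L P` and the Scott space of a directed completion of `P` are recognized by the
same property: there is a quasi-homeomorphism from `Σ_L P` to it, that is, a continuous map inducing
a bijection on open `L`-subsets. The space of points of `σ_L(P)` is the universal example. Such a
map transports the open `L`-subsets `{x | z ≪ x}` of `P` to a core basis: every open `A` of the
target is a join `⋁ᵢ A(bᵢ) ∧ Wᵢ` with `Wᵢ` open inside the core of `bᵢ`. This makes the target
locally super-compact. If it is also sober, the `bᵢ` approximating a point `x`, each to the degree
`Wᵢ(x)`, form a directed `L`-subset of `⇓x` with supremum `x`, so the specialization order is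
a continuous `L`-dcpo whose Scott topology is the given topology. Conversely, in the Scott space of
a continuous `L`-dcpo the supremum of the approximants of a point of the frame represents that
point, so the space is sober, and its specialization order is the given order.
-/

section LSubsets

variable {L : Type u} [Order.Frame L] {X : Type v} {Y : Type w}

theorem le_lsub_iff {A B : X → L} {c : L} : c ≤ lsub A B ↔ ∀ x, c ⊓ A x ≤ B x := by
  simp only [lsub, le_iInf_iff, le_himp_iff]

theorem lsub_inf_apply_le (A B : X → L) (x : X) : lsub A B ⊓ A x ≤ B x :=
  le_lsub_iff.1 le_rfl x

theorem le_zadehImage (f : X → Y) (A : X → L) (x : X) : A x ≤ zadehImage f A (f x) :=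
  le_iSup₂_of_le (f := fun a (_ : f a = f x) => A a) x rfl le_rfl

theorem iSup_inf_zadehImage (f : X → Y) (A : X → L) (B : Y → L) :
    ⨆ y, B y ⊓ zadehImage f A y = ⨆ x, B (f x) ⊓ A x := by
  simp only [zadehImage, inf_iSup_eq]
  rw [iSup_comm]
  simp only [iSup_iSup_eq_right]

end LSubsets

namespace LOrder

variable {L : Type u} [Order.Frame L] {P : Type v} {e : LOrder L P}

/-! ### Suprema and directed `L`-subsets -/

theorem isSup_iff {A : P → L} {s : P} :
    e.IsSup A s ↔ (∀ x, A x ≤ e.rel x s) ∧ ∀ t, lsub A (e.lower t) ≤ e.rel s t := by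
  refine ⟨fun h => ⟨fun x => ?_, fun t => (h t).ge⟩, fun ⟨hub, hleast⟩ t =>
    le_antisymm (le_lsub_iff.2 fun x => ?_) (hleast t)⟩
  · have hsub : lsub A (e.lower s) = ⊤ := (h s).symm.trans (e.rel_refl s)
    simpa [hsub, lower] using lsub_inf_apply_le A (e.lower s) x
  · have := e.rel_trans x s t
    have := hub x
    unfold lower
    order

theorem IsSup.le_rel {A : P → L} {s : P} (h : e.IsSup A s) (x : P) : A x ≤ e.rel x s :=
  (isSup_iff.1 h).1 x

theorem IsSup.unique {A : P → L} {s t : P} (hs : e.IsSup A s) (ht : e.IsSup A t) : s = t := by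
  refine e.rel_antisymm s t ?_
  rw [hs t, ← ht t, ht s, ← hs s, e.rel_refl, e.rel_refl, inf_top_eq]

theorem isDirected_lower (x : P) : e.IsDirected (e.lower x) := by
  refine ⟨top_le_iff.1 (le_iSup_of_le x (e.rel_refl x).ge), fun a b => le_iSup_of_le x ?_⟩
  simp only [lower, e.rel_refl, top_inf_eq, le_refl]

theorem isSup_lower (x : P) : e.IsSup (e.lower x) x :=
  isSup_iff.2 ⟨fun _ => le_rfl, fun t => by
    simpa [lower, e.rel_refl] using lsub_inf_apply_le (e.lower x) (e.lower t) x⟩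

theorem IsDirected.iSup_inf {D : P → L} {F : P → P → L} (hD : e.IsDirected D)
    (hF : ∀ z, e.IsDirected (F z)) (hmono : ∀ z w y, F z y ⊓ e.rel z w ≤ F w y) :
    e.IsDirected fun y => ⨆ z, D z ⊓ F z y := by
  constructor
  · rw [iSup_comm]
    simp only [← inf_iSup_eq, (hF _).1, inf_top_eq, hD.1]
  intro a b
  have meet_at (w : P) : D w ⊓ F w a ⊓ F w b ≤
      ⨆ y, (⨆ z, D z ⊓ F z y) ⊓ e.rel a y ⊓ e.rel b y := by
    rw [inf_assoc]
    refine (inf_le_inf_left _ ((hF w).2 a b)).trans ?_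
    simp only [inf_iSup_eq, iSup_inf_eq]
    refine iSup_mono fun y => le_iSup_of_le w ?_
    order
  simp only [iSup_inf_eq (f := fun z => D z ⊓ F z a), inf_iSup_eq (f := fun z => D z ⊓ F z b)]
  refine iSup₂_le fun z z' => ?_
  calc D z ⊓ F z a ⊓ (D z' ⊓ F z' b)
      = D z ⊓ D z' ⊓ (F z a ⊓ F z' b) := inf_inf_inf_comm _ _ _ _
    _ ≤ (⨆ w, D w ⊓ e.rel z w ⊓ e.rel z' w) ⊓ (F z a ⊓ F z' b) :=
        inf_le_inf_right _ (hD.2 z z')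
    _ = ⨆ w, D w ⊓ e.rel z w ⊓ e.rel z' w ⊓ (F z a ⊓ F z' b) := iSup_inf_eq _ _
    _ ≤ ⨆ w, D w ⊓ F w a ⊓ F w b := iSup_mono fun w => by
        have := hmono z w a
        have := hmono z' w b
        order
    _ ≤ _ := iSup_le meet_at

theorem IsSup.iSup_inf {D : P → L} {F : P → P → L} {x : P} (hD : e.IsSup D x)
    (hF : ∀ z, e.IsSup (F z) z) : e.IsSup (fun y => ⨆ z, D z ⊓ F z y) x := by
  intro t
  calc e.rel x t = ⨅ z, D z ⇨ e.rel z t := hD t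
    _ = ⨅ z, D z ⇨ ⨅ y, F z y ⇨ e.rel y t := iInf_congr fun z => congrArg _ (hF z t)
    _ = ⨅ y, ⨅ z, D z ⊓ F z y ⇨ e.rel y t := by
        simp only [himp_iInf_eq, himp_himp]
        exact iInf_comm
    _ = lsub (fun y => ⨆ z, D z ⊓ F z y) (e.lower t) := by
        simp only [lsub, lower, iSup_himp_eq]

/-- The lower closure `↓D` of an `L`-subset: the value at `y` is the degree to which `y` is below
some element of `D`. -/
def lowerClosure (e : LOrder L P) (D : P → L) : P → L := fun y => ⨆ d, D d ⊓ e.rel y d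

theorem IsDirected.lowerClosure {D : P → L} (hD : e.IsDirected D) :
    e.IsDirected (e.lowerClosure D) :=
  hD.iSup_inf isDirected_lower fun z w y => e.rel_trans y z w

theorem IsSup.lowerClosure {D : P → L} {x : P} (hD : e.IsSup D x) :
    e.IsSup (e.lowerClosure D) x :=
  hD.iSup_inf isSup_lower

theorem rel_inf_lowerClosure_le (D : P → L) (x y : P) :
    e.rel x y ⊓ e.lowerClosure D y ≤ e.lowerClosure D x := by
  simp only [LOrder.lowerClosure, inf_iSup_eq]
  refine iSup_mono fun d => ?_
  have := e.rel_trans x y d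
  order

/-! ### The way-below relation -/

theorem le_wayBelow_iff {x y : P} {c : L} :
    c ≤ e.wayBelow x y ↔ ∀ (D : P → L) (s : P), e.IsDirected D → e.IsSup D s →
      c ⊓ e.rel x s ≤ e.lowerClosure D y := by
  simp only [wayBelow, le_iInf_iff, le_himp_iff, LOrder.lowerClosure]

theorem wayBelow_le_lowerClosure {D : P → L} {x : P} (hD : e.IsDirected D) (hs : e.IsSup D x) :
    e.wayBelow x ≤ e.lowerClosure D := fun y => by
  simpa [e.rel_refl] using le_wayBelow_iff.1 (le_refl (e.wayBelow x y)) D x hD hs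

theorem rel_inf_wayBelow_le (x y z : P) : e.rel y z ⊓ e.wayBelow x z ≤ e.wayBelow x y :=
  le_wayBelow_iff.2 fun D s hD hs => by
    have := le_wayBelow_iff.1 (le_refl (e.wayBelow x z)) D s hD hs
    have := e.rel_inf_lowerClosure_le D y z
    order

theorem wayBelow_inf_rel_le (x y z : P) : e.wayBelow x z ⊓ e.rel x y ≤ e.wayBelow y z :=
  le_wayBelow_iff.2 fun D s hD hs => by
    have := le_wayBelow_iff.1 (le_refl (e.wayBelow x z)) D s hD hs
    have := e.rel_trans x y s
    order

theorem wayBelow_eq_lowerClosure {D : P → L} {x : P} (hD : e.IsDirected D) (hs : e.IsSup D x)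
    (hle : D ≤ e.wayBelow x) : e.wayBelow x = e.lowerClosure D :=
  le_antisymm (wayBelow_le_lowerClosure hD hs) fun y => iSup_le fun d =>
    (inf_le_inf_right _ (hle d)).trans (inf_comm _ _ |>.trans_le (e.rel_inf_wayBelow_le x y d))

theorem isContinuous_of_exists_le_wayBelow
    (h : ∀ x, ∃ D, e.IsDirected D ∧ e.IsSup D x ∧ D ≤ e.wayBelow x) : e.IsContinuous := by
  intro x
  obtain ⟨D, hD, hs, hle⟩ := h x
  rw [wayBelow_eq_lowerClosure hD hs hle]
  exact ⟨hD.lowerClosure, hs.lowerClosure⟩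

namespace IsContinuous

variable (he : e.IsContinuous)
include he

theorem wayBelow_le_rel (x y : P) : e.wayBelow x y ≤ e.rel y x := (he x).2.le_rel y

theorem wayBelow_interpolation (x y : P) :
    e.wayBelow x y ≤ ⨆ z, e.wayBelow x z ⊓ e.wayBelow z y := by
  -- `D = ⋃_{z ≪ x} ⇓z` is again directed with supremum `x`, so `⇓x ≤ ↓D`.
  have hD : e.IsDirected fun y => ⨆ z, e.wayBelow x z ⊓ e.wayBelow z y :=
    (he x).1.iSup_inf (fun z => (he z).1) fun z w y => e.wayBelow_inf_rel_le z w y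
  have hs : e.IsSup (fun y => ⨆ z, e.wayBelow x z ⊓ e.wayBelow z y) x :=
    (he x).2.iSup_inf fun z => (he z).2
  refine (wayBelow_le_lowerClosure hD hs y).trans ?_
  simp only [LOrder.lowerClosure, iSup_inf_eq]
  refine iSup₂_le fun d z => le_iSup_of_le z ?_
  have := e.rel_inf_wayBelow_le z y d
  order

theorem isScottOpen_wayBelow (y : P) : e.IsScottOpen fun x => e.wayBelow x y := by
  refine ⟨fun a b => e.wayBelow_inf_rel_le a b y,
    fun D s hD hs => le_antisymm ?_ (iSup_le fun x => ?_)⟩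
  · calc e.wayBelow s y ≤ ⨆ z, e.wayBelow s z ⊓ e.wayBelow z y := he.wayBelow_interpolation s y
      _ ≤ ⨆ z, e.lowerClosure D z ⊓ e.wayBelow z y :=
          iSup_mono fun z => inf_le_inf_right _ (wayBelow_le_lowerClosure hD hs z)
      _ = ⨆ z, ⨆ d, D d ⊓ e.rel z d ⊓ e.wayBelow z y := by
          simp only [LOrder.lowerClosure, iSup_inf_eq]
      _ ≤ ⨆ d, e.wayBelow d y ⊓ D d := iSup₂_le fun z d => le_iSup_of_le d (by
          have := e.wayBelow_inf_rel_le z d y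
          order)
  · have := e.wayBelow_inf_rel_le x s y
    have := hs.le_rel x
    order

theorem rel_eq_iInf_opens (x y : P) :
    e.rel x y = ⨅ A : e.scottTopology.opens, A.1 x ⇨ A.1 y := by
  refine le_antisymm (le_iInf fun A => ?_)
    (((isSup_iff.1 (he x).2).2 y).trans' (le_lsub_iff.2 fun z => ?_))
  · rw [le_himp_iff, inf_comm]
    exact A.2.1 x y
  · have hz := iInf_le (fun A : e.scottTopology.opens => A.1 x ⇨ A.1 y)
      ⟨_, he.isScottOpen_wayBelow z⟩
    exact (le_himp_iff.1 hz).trans (he.wayBelow_le_rel y z)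

theorem isT0_scottTopology : e.scottTopology.IsT0 := by
  intro x y h
  refine e.rel_antisymm x y ?_
  rw [he.rel_eq_iInf_opens, he.rel_eq_iInf_opens, inf_eq_top_iff]
  simp only [iInf_eq_top, himp_eq_top_iff]
  exact ⟨fun A => (h A.1 A.2).le, fun A => (h A.1 A.2).ge⟩

theorem specializationOrder_scottTopology (h : e.scottTopology.IsT0) :
    e.scottTopology.specializationOrder h = e :=
  LOrder.ext (funext₂ fun x y => (he.rel_eq_iInf_opens x y).symm)

end IsContinuous

end LOrder

namespace LTopology

variable {L : Type u} [Order.Frame L] {X : Type v} {Y : Type w} {Z : Type*} {τ : LTopology L X}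
  {τ' : LTopology L Y} {τ'' : LTopology L Z}

/-! ### Open `L`-subsets and points -/

theorem iSup_mem {ι : Sort*} {A : ι → X → L} (h : ∀ i, A i ∈ τ.opens) :
    (fun x => ⨆ i, A i x) ∈ τ.opens := by
  have hrange : (fun x => ⨆ i, A i x) = sSup (Set.range A) := by
    funext x
    rw [sSup_range, iSup_apply]
  rw [hrange]
  exact τ.sSup_mem (Set.range_subset_iff.2 h)

theorem const_inf_mem {A : X → L} (a : L) (h : A ∈ τ.opens) : (fun x => a ⊓ A x) ∈ τ.opens :=
  τ.inf_mem (τ.const_mem a) h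

theorem ContinuousMap.comp {g : Y → Z} {f : X → Y} (hg : τ'.ContinuousMap τ'' g)
    (hf : τ.ContinuousMap τ' f) : τ.ContinuousMap τ'' (g ∘ f) :=
  fun C hC => hf _ (hg C hC)

attribute [ext] Point

namespace Point

theorem map_iSup (p : τ.Point) {ι : Sort*} {A : ι → X → L} (h : ∀ i, A i ∈ τ.opens) :
    p.toFun ⟨_, iSup_mem h⟩ = ⨆ i, p.toFun ⟨A i, h i⟩ := by
  have hrange : (⟨_, iSup_mem h⟩ : τ.opens) =
      ⟨sSup (Set.range A), τ.sSup_mem (Set.range_subset_iff.2 h)⟩ :=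
    Subtype.ext (funext fun x => by simp only [sSup_range, iSup_apply])
  rw [hrange, p.map_sSup]
  exact ((Set.rangeFactorization_surjective (f := A)).iSup_comp fun B =>
    p.toFun ⟨B.1, Set.range_subset_iff.2 h B.2⟩).symm

theorem map_const_inf (p : τ.Point) (a : L) (A : τ.opens) :
    p.toFun ⟨_, const_inf_mem a A.2⟩ = a ⊓ p.toFun A :=
  (p.map_inf ⟨_, τ.const_mem a⟩ A).trans (by rw [p.map_const])

/-- The image of a point under a continuous map. -/
def map {f : X → Y} (hf : τ.ContinuousMap τ' f) (p : τ.Point) : τ'.Point where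
  toFun B := p.toFun ⟨B.1 ∘ f, hf B.1 B.2⟩
  map_inf A B := p.map_inf ⟨A.1 ∘ f, hf A.1 A.2⟩ ⟨B.1 ∘ f, hf B.1 B.2⟩
  map_sSup S hS := by
    rw [← p.map_iSup fun B : S => hf B.1 (hS B.2)]
    congr 2
  map_const a := p.map_const a

end Point

/-! ### Quasi-homeomorphisms and sobrification -/

/-- A quasi-homeomorphism: a continuous map `j` for which `A ↦ A ∘ j` is a bijection between the
open `L`-subsets. -/
structure IsQuasiHomeomorphism (τ : LTopology L X) (τ' : LTopology L Y) (j : X → Y) : Prop where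
  continuousMap : τ.ContinuousMap τ' j
  injective : ∀ A ∈ τ'.opens, ∀ B ∈ τ'.opens, A ∘ j = B ∘ j → A = B
  surjective : ∀ C ∈ τ.opens, ∃ A ∈ τ'.opens, A ∘ j = C

namespace IsQuasiHomeomorphism

variable {j : X → Y}

/-- The unique open `L`-subset of the codomain that extends a given one along `j`. -/
noncomputable def extend (hj : IsQuasiHomeomorphism τ τ' j) (C : τ.opens) : τ'.opens :=
  ⟨(hj.surjective C.1 C.2).choose, (hj.surjective C.1 C.2).choose_spec.1⟩

theorem extend_comp (hj : IsQuasiHomeomorphism τ τ' j) (C : τ.opens) :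
    (hj.extend C).1 ∘ j = C.1 :=
  (hj.surjective C.1 C.2).choose_spec.2

theorem extend_apply (hj : IsQuasiHomeomorphism τ τ' j) (C : τ.opens) (x : X) :
    (hj.extend C).1 (j x) = C.1 x :=
  congrFun (hj.extend_comp C) x

theorem extend_eq (hj : IsQuasiHomeomorphism τ τ' j) {C : τ.opens} {A : Y → L}
    (hA : A ∈ τ'.opens) (h : ∀ x, A (j x) = C.1 x) : hj.extend C = ⟨A, hA⟩ :=
  Subtype.ext <| hj.injective _ (hj.extend C).2 _ hA <|
    (hj.extend_comp C).trans (funext h).symm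

/-- The inverse of `Point.map` along a quasi-homeomorphism. -/
noncomputable def comapPoint (hj : IsQuasiHomeomorphism τ τ' j) (q : τ'.Point) : τ.Point where
  toFun C := q.toFun (hj.extend C)
  map_inf A B := by
    rw [← q.map_inf]
    refine congrArg q.toFun (hj.extend_eq _ fun x => ?_)
    simp only [Pi.inf_apply, hj.extend_apply]
  map_sSup S hS := by
    rw [← q.map_iSup fun A : S => (hj.extend ⟨A.1, hS A.2⟩).2]
    refine congrArg q.toFun (hj.extend_eq _ fun x => ?_)
    simp only [hj.extend_apply, sSup_apply]
  map_const a := by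
    rw [hj.extend_eq (τ'.const_mem a) fun _ => rfl, q.map_const]

theorem existsUnique_lift (hj : IsQuasiHomeomorphism τ τ' j) (hZ : τ''.IsSober) {f : X → Z}
    (hf : τ.ContinuousMap τ'' f) : ∃! g : Y → Z, τ'.ContinuousMap τ'' g ∧ g ∘ j = f := by
  choose g hg using fun y => hZ.2 ((hj.comapPoint (τ'.evalPoint y)).map hf)
  have comp_g (C : τ''.opens) : C.1 ∘ g = (hj.extend ⟨C.1 ∘ f, hf C.1 C.2⟩).1 :=
    funext fun y => congrFun (congrArg Point.toFun (hg y)) C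
  refine ⟨g, ⟨fun C hC => ?_, funext fun x => hZ.isT0 _ _ fun C hC => ?_⟩,
    fun g' ⟨hg', hg'j⟩ => funext fun y => hZ.isT0 _ _ fun C hC => ?_⟩
  · rw [comp_g ⟨C, hC⟩]
    exact Subtype.property _
  · exact (congrFun (comp_g ⟨C, hC⟩) (j x)).trans (hj.extend_apply _ x)
  · have hext := hj.extend_eq (C := ⟨C ∘ f, hf C hC⟩) (hg' C hC)
      fun x => congrArg C (congrFun hg'j x)
    exact congrFun ((congrArg Subtype.val hext).symm.trans (comp_g ⟨C, hC⟩).symm) y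

theorem of_retract (hj : IsQuasiHomeomorphism τ τ' j) {i : X → Z} {h : Z → Y} {k : Y → Z}
    (hh : τ''.ContinuousMap τ' h) (hk : τ'.ContinuousMap τ'' k) (hhi : h ∘ i = j)
    (hkj : k ∘ j = i) (hkh : k ∘ h = id) : IsQuasiHomeomorphism τ τ'' i where
  continuousMap := hkj ▸ hk.comp hj.continuousMap
  injective A hA B hB hAB := by
    have hABk : A ∘ k = B ∘ k := hj.injective _ (hk A hA) _ (hk B hB) (by
      simpa only [Function.comp_assoc, hkj] using hAB)
    simpa only [Function.comp_assoc, hkh, Function.comp_id] using congrArg (· ∘ h) hABk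
  surjective C hC := by
    obtain ⟨A, hA, rfl⟩ := hj.surjective C hC
    exact ⟨A ∘ h, hh A hA, by rw [Function.comp_assoc, hhi]⟩

end IsQuasiHomeomorphism

/-- The space of points of `𝒪(X)`, whose open `L`-subsets are the evaluations `p ↦ p(A)` at open
`A`; it is the standard `L`-sobrification of `X`. -/
def pointTopology (τ : LTopology L X) : LTopology L τ.Point where
  opens := Set.range fun (A : τ.opens) (p : τ.Point) => p.toFun A
  inf_mem := by
    rintro _ _ ⟨A, rfl⟩ ⟨B, rfl⟩
    exact ⟨⟨_, τ.inf_mem A.2 B.2⟩, funext fun p => p.map_inf A B⟩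
  sSup_mem := by
    intro S hS
    choose F hF using hS
    refine ⟨⟨_, iSup_mem (A := fun B : S => (F B.2).1) fun B => (F B.2).2⟩, funext fun p => ?_⟩
    simp only [p.map_iSup fun B : S => (F B.2).2, sSup_apply]
    exact iSup_congr fun B => congrFun (hF B.2) p
  const_mem a := ⟨⟨_, τ.const_mem a⟩, funext fun p => p.map_const a⟩

theorem isQuasiHomeomorphism_evalPoint : IsQuasiHomeomorphism τ τ.pointTopology τ.evalPoint where
  continuousMap := by
    rintro _ ⟨A, rfl⟩
    exact A.2
  injective := by
    rintro _ ⟨A, rfl⟩ _ ⟨B, rfl⟩ h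
    rw [show A = B from Subtype.ext h]
  surjective C hC := ⟨_, ⟨⟨C, hC⟩, rfl⟩, rfl⟩

theorem isSober_pointTopology : τ.pointTopology.IsSober := by
  refine ⟨fun p q h => Point.ext (funext fun A => ?_), fun q =>
    ⟨isQuasiHomeomorphism_evalPoint.comapPoint q, Point.ext (funext ?_)⟩⟩
  · exact congrFun (congrArg Point.toFun h) ⟨fun p => p.toFun A, A, rfl⟩
  · rintro ⟨_, A, rfl⟩
    exact congrArg q.toFun (isQuasiHomeomorphism_evalPoint.extend_eq _ fun _ => rfl)

theorem IsSober.isQuasiHomeomorphism (hY : τ'.IsSober) {j : X → Y} (hj : τ.ContinuousMap τ' j)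
    {h : Y → τ.Point} (hh : τ'.ContinuousMap τ.pointTopology h) (hhj : h ∘ j = τ.evalPoint)
    (eq_id : ∀ g : Y → Y, τ'.ContinuousMap τ' g → g ∘ j = j → g = id) :
    IsQuasiHomeomorphism τ τ' j := by
  obtain ⟨k, ⟨hk, hkj⟩, -⟩ := isQuasiHomeomorphism_evalPoint.existsUnique_lift hY hj
  have hkh : k ∘ h = id := eq_id _ (hk.comp hh) (by rw [Function.comp_assoc, hhj, hkj])
  exact isQuasiHomeomorphism_evalPoint.of_retract hh hk hhj hkj hkh

/-! ### The specialization order -/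

/-- The core `↑x` of a point: the values of the specialization `L`-order above `x`. Unlike
`specializationOrder`, it makes sense in spaces that are not `T₀`. -/
def core (τ : LTopology L X) (x : X) : X → L := fun y => ⨅ A : τ.opens, A.1 x ⇨ A.1 y

theorem core_self (x : X) : τ.core x x = ⊤ := by
  simp only [core, himp_self, iInf_top]

theorem le_core_iff {x y : X} {c : L} :
    c ≤ τ.core x y ↔ ∀ A ∈ τ.opens, c ⊓ A x ≤ A y := by
  simp only [core, le_iInf_iff, le_himp_iff, Subtype.forall]

theorem apply_inf_core_le {A : X → L} (hA : A ∈ τ.opens) (x y : X) :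
    A x ⊓ τ.core x y ≤ A y := by
  rw [inf_comm]
  exact le_core_iff.1 le_rfl A hA

theorem lsub_core {A : X → L} (hA : A ∈ τ.opens) (x : X) : lsub (τ.core x) A = A x := by
  refine le_antisymm ?_ (le_lsub_iff.2 fun y => apply_inf_core_le hA x y)
  simpa only [core_self, inf_top_eq] using lsub_inf_apply_le (τ.core x) A x

theorem isSuperCompact_core (x : X) : τ.IsSuperCompact (τ.core x) := by
  refine ⟨top_le_iff.1 (le_iSup_of_le x (core_self x).ge), fun S hS => ?_⟩
  rw [lsub_core (τ.sSup_mem hS), sSup_apply]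
  exact iSup_congr fun V => (lsub_core (hS V.2) x).symm

theorem isSup_specializationOrder (h : τ.IsT0) {D : X → L} {s : X}
    (hs : ∀ A ∈ τ.opens, A s = ⨆ x, A x ⊓ D x) : (τ.specializationOrder h).IsSup D s := by
  refine LOrder.isSup_iff.2 ⟨fun x => le_core_iff.2 fun A hA => ?_,
    fun t => le_core_iff.2 fun A hA => ?_⟩
  · rw [hs A hA, inf_comm]
    exact le_iSup (fun x => A x ⊓ D x) x
  · rw [hs A hA, inf_iSup_eq]
    refine iSup_le fun x => ?_
    have hDx : lsub D ((τ.specializationOrder h).lower t) ⊓ D x ≤ τ.core x t :=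
      lsub_inf_apply_le D _ x
    have := apply_inf_core_le hA x t
    order

/-- The point `A ↦ ⋁ₓ A(x) ∧ D(x)` to which a directed `L`-subset `D` converges. -/
def limitPoint (h : τ.IsT0) {D : X → L} (hD : (τ.specializationOrder h).IsDirected D) :
    τ.Point where
  toFun A := ⨆ x, A.1 x ⊓ D x
  map_inf A B := by
    have meet_le (x y : X) : A.1 x ⊓ D x ⊓ (B.1 y ⊓ D y) ≤ ⨆ z, (A.1 ⊓ B.1) z ⊓ D z :=
      calc A.1 x ⊓ D x ⊓ (B.1 y ⊓ D y) = A.1 x ⊓ B.1 y ⊓ (D x ⊓ D y) := inf_inf_inf_comm _ _ _ _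
        _ ≤ A.1 x ⊓ B.1 y ⊓ ⨆ z, D z ⊓ τ.core x z ⊓ τ.core y z :=
            inf_le_inf_left _ (hD.2 x y)
        _ = ⨆ z, A.1 x ⊓ B.1 y ⊓ (D z ⊓ τ.core x z ⊓ τ.core y z) := inf_iSup_eq _ _
        _ ≤ ⨆ z, (A.1 ⊓ B.1) z ⊓ D z := iSup_mono fun z => by
            have := apply_inf_core_le A.2 x z
            have := apply_inf_core_le B.2 y z
            rw [Pi.inf_apply]
            order
    refine le_antisymm (le_inf (iSup_mono fun x => inf_le_inf_right _ inf_le_left)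
      (iSup_mono fun x => inf_le_inf_right _ inf_le_right)) ?_
    rw [iSup_inf_iSup]
    exact iSup_le fun z => meet_le z.1 z.2
  map_sSup S hS := by
    simp only [sSup_apply, iSup_inf_eq]
    exact iSup_comm
  map_const a := by rw [← inf_iSup_eq, hD.1, inf_top_eq]

namespace IsSober

theorem exists_apply_eq_iSup (h : τ.IsSober) {D : X → L}
    (hD : (τ.specializationOrder h.isT0).IsDirected D) :
    ∃ s, ∀ A ∈ τ.opens, A s = ⨆ x, A x ⊓ D x := by
  obtain ⟨s, hs⟩ := h.2 (limitPoint h.isT0 hD)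
  exact ⟨s, fun A hA => congrFun (congrArg Point.toFun hs) ⟨A, hA⟩⟩

theorem isDcpo_specializationOrder (h : τ.IsSober) : (τ.specializationOrder h.isT0).IsDcpo :=
  fun _ hD => (h.exists_apply_eq_iSup hD).imp fun _ => isSup_specializationOrder h.isT0

theorem isScottOpen (h : τ.IsSober) {A : X → L} (hA : A ∈ τ.opens) :
    (τ.specializationOrder h.isT0).IsScottOpen A := by
  refine ⟨apply_inf_core_le hA, fun D s hD hs => ?_⟩
  obtain ⟨t, ht⟩ := h.exists_apply_eq_iSup hD
  rw [hs.unique (isSup_specializationOrder h.isT0 ht), ht A hA]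

end IsSober

/-! ### Core bases -/

/-- A core basis: points `b i` together with open `L`-subsets `W i` such that every open `A` is the
join of the `A(b i) ∧ W i`. Each `W i` is then contained in the core of `b i`. The Scott space of a
continuous `L`-ordered set has the core basis `b z = z`, `W z = {x | z ≪ x}`. -/
structure IsCoreBasis {ι : Type*} (τ : LTopology L X) (b : ι → X) (W : ι → X → L) : Prop where
  isOpen : ∀ i, W i ∈ τ.opens
  apply_eq_iSup : ∀ A ∈ τ.opens, ∀ x, A x = ⨆ i, A (b i) ⊓ W i x

theorem IsQuasiHomeomorphism.isCoreBasis {j : X → Y} (hj : IsQuasiHomeomorphism τ τ' j)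
    {ι : Type*} {b : ι → X} {W : ι → X → L} (hb : τ.IsCoreBasis b W) :
    τ'.IsCoreBasis (j ∘ b) fun i => (hj.extend ⟨W i, hb.isOpen i⟩).1 where
  isOpen _ := Subtype.property _
  apply_eq_iSup A hA := congrFun <|
    hj.injective _ hA _ (iSup_mem fun _ => const_inf_mem _ (Subtype.property _)) <| funext fun x =>
      (hb.apply_eq_iSup _ (hj.continuousMap A hA) x).trans <| iSup_congr fun i =>
        congrArg (A (j (b i)) ⊓ ·) (hj.extend_apply ⟨W i, hb.isOpen i⟩ x).symm

namespace IsCoreBasis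

variable {ι : Type*} {b : ι → X} {W : ι → X → L}

theorem le_core (hb : τ.IsCoreBasis b W) (i : ι) : W i ≤ τ.core (b i) := fun x =>
  le_core_iff.2 fun A hA => by
    rw [hb.apply_eq_iSup A hA x, inf_comm]
    exact le_iSup (fun i => A (b i) ⊓ W i x) i

theorem isLocallySuperCompact (hb : τ.IsCoreBasis b W) : τ.IsLocallySuperCompact := by
  intro A hA x
  refine le_antisymm ?_ (iSup₂_le fun B _ => ?_)
  · rw [hb.apply_eq_iSup A hA x]
    refine iSup_le fun i => le_iSup₂_of_le (τ.core (b i)) (isSuperCompact_core (b i)) ?_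
    have hint : W i ≤ τ.interior (τ.core (b i)) := le_sSup ⟨hb.isOpen i, hb.le_core i⟩
    rw [lsub_core hA]
    exact inf_le_inf_left _ (hint x)
  · have hint : τ.interior B ≤ B := sSup_le fun _ h => h.2
    exact (inf_le_inf_left _ (hint x)).trans (lsub_inf_apply_le B A x)

theorem point_apply_eq_iSup (hb : τ.IsCoreBasis b W) (p : τ.Point) (A : τ.opens) :
    p.toFun A = ⨆ i, A.1 (b i) ⊓ p.toFun ⟨W i, hb.isOpen i⟩ := by
  simp only [← p.map_const_inf]
  rw [← p.map_iSup fun i => const_inf_mem (A.1 (b i)) (hb.isOpen i)]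
  exact congrArg p.toFun (Subtype.ext (funext (hb.apply_eq_iSup A.1 A.2)))

/-- The directed `L`-subset of basis points that a point `p` of `𝒪(X)` determines: `b i` belongs to
it to the degree `p(W i)`. -/
def approximants (hb : τ.IsCoreBasis b W) (p : τ.Point) : X → L :=
  zadehImage b fun i => p.toFun ⟨W i, hb.isOpen i⟩

theorem iSup_inf_approximants (hb : τ.IsCoreBasis b W) (p : τ.Point) (A : τ.opens) :
    ⨆ x, A.1 x ⊓ hb.approximants p x = p.toFun A :=
  (iSup_inf_zadehImage b _ A.1).trans (hb.point_apply_eq_iSup p A).symm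

theorem isDirected_approximants (hb : τ.IsCoreBasis b W) (h : τ.IsT0) (p : τ.Point) :
    (τ.specializationOrder h).IsDirected (hb.approximants p) := by
  constructor
  · simpa only [top_inf_eq, p.map_const] using
      hb.iSup_inf_approximants p ⟨_, τ.const_mem ⊤⟩
  intro x y
  simp only [approximants, zadehImage, iSup_inf_eq, inf_iSup_eq]
  refine iSup₂_le fun i hi => iSup₂_le fun i' hi' => ?_
  subst hi hi'
  rw [← p.map_inf, hb.point_apply_eq_iSup]
  refine iSup_le fun k => le_iSup_of_le (b k) (le_iSup₂_of_le k rfl ?_)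
  have : W i (b k) ≤ (τ.specializationOrder h).rel (b i) (b k) := hb.le_core i (b k)
  have : W i' (b k) ≤ (τ.specializationOrder h).rel (b i') (b k) := hb.le_core i' (b k)
  simp only [Pi.inf_apply]
  order

theorem isSober (hb : τ.IsCoreBasis b W) (h : τ.IsT0)
    (hdcpo : (τ.specializationOrder h).IsDcpo)
    (hopen : ∀ A ∈ τ.opens, (τ.specializationOrder h).IsScottOpen A) : τ.IsSober := by
  refine ⟨fun x y hxy => h x y fun A hA => congrFun (congrArg Point.toFun hxy) ⟨A, hA⟩,
    fun p => ?_⟩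
  have hD := hb.isDirected_approximants h p
  obtain ⟨s, hs⟩ := hdcpo _ hD
  refine ⟨s, Point.ext (funext fun A => ?_)⟩
  exact ((hopen A.1 A.2).2 _ s hD hs).trans (hb.iSup_inf_approximants p A)

theorem isSup_approximants_evalPoint (hb : τ.IsCoreBasis b W) (h : τ.IsT0) (x : X) :
    (τ.specializationOrder h).IsSup (hb.approximants (τ.evalPoint x)) x :=
  isSup_specializationOrder h fun A hA => (hb.iSup_inf_approximants (τ.evalPoint x) ⟨A, hA⟩).symm

theorem approximants_evalPoint_le_wayBelow (hb : τ.IsCoreBasis b W) (h : τ.IsSober) (x : X) :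
    hb.approximants (τ.evalPoint x) ≤ (τ.specializationOrder h.isT0).wayBelow x := by
  refine fun y => iSup₂_le fun i hi => LOrder.le_wayBelow_iff.2 fun D s hD hs => ?_
  subst hi
  calc W i x ⊓ τ.core x s ≤ W i s := apply_inf_core_le (hb.isOpen i) x s
    _ = ⨆ z, W i z ⊓ D z := (h.isScottOpen (hb.isOpen i)).2 D s hD hs
    _ ≤ ⨆ z, D z ⊓ τ.core (b i) z := iSup_mono fun z => by
        rw [inf_comm]
        exact inf_le_inf_left _ (hb.le_core i z)

theorem isContinuous_specializationOrder (hb : τ.IsCoreBasis b W) (h : τ.IsSober) :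
    (τ.specializationOrder h.isT0).IsContinuous :=
  LOrder.isContinuous_of_exists_le_wayBelow fun x => ⟨hb.approximants (τ.evalPoint x),
    hb.isDirected_approximants h.isT0 _, hb.isSup_approximants_evalPoint h.isT0 x,
    hb.approximants_evalPoint_le_wayBelow h x⟩

theorem scottTopology_specializationOrder (hb : τ.IsCoreBasis b W) (h : τ.IsSober) :
    (τ.specializationOrder h.isT0).scottTopology = τ := by
  refine LTopology.ext (Set.ext fun A => ⟨fun hA => ?_, h.isScottOpen⟩)
  have hA_eq : A = fun x => ⨆ i, A (b i) ⊓ W i x := funext fun x =>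
    (hA.2 _ x (hb.isDirected_approximants h.isT0 _)
      (hb.isSup_approximants_evalPoint h.isT0 x)).trans (iSup_inf_zadehImage b _ A)
  rw [hA_eq]
  exact iSup_mem fun i => const_inf_mem _ (hb.isOpen i)

end IsCoreBasis

end LTopology

/-! ### Scott continuity and continuity -/

namespace LOrder

variable {L : Type u} [Order.Frame L] {P : Type v} {Q : Type w} {e : LOrder L P}
  {e' : LOrder L Q} {f : P → Q}

-- `ScottContinuous.orderPreserving` and its companions confine `P` and `Q` to one universe, but the
-- directed completions of `P` live in a larger one.

theorem ScottContinuous.rel_le (hf : e.ScottContinuous e' f) : e.OrderPreserving e' f :=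
  fun x y => (le_zadehImage f (e.lower y) x).trans
    ((hf _ _ (isDirected_lower y) (isSup_lower y)).le_rel (f x))

theorem OrderPreserving.isDirected_zadehImage (hf : e.OrderPreserving e' f) {D : P → L}
    (hD : e.IsDirected D) : e'.IsDirected (zadehImage f D) := by
  constructor
  · exact top_le_iff.1 (hD.1.symm.trans_le
      (iSup_le fun x => (le_zadehImage f D x).trans (le_iSup (zadehImage f D) (f x))))
  intro a b
  simp only [zadehImage, iSup_inf_eq, inf_iSup_eq]
  refine iSup₂_le fun y hy => iSup₂_le fun x hx => ?_
  subst hy hx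
  refine (hD.2 _ _).trans (iSup_le fun z => le_iSup_of_le (f z) (le_iSup₂_of_le z rfl ?_))
  exact inf_le_inf (inf_le_inf_left _ (hf _ _)) (hf _ _)

theorem ScottContinuous.continuousMap_scottTopology (hf : e.ScottContinuous e' f) :
    e.scottTopology.ContinuousMap e'.scottTopology f := by
  refine fun B hB => ⟨fun x y => (inf_le_inf_left _ (hf.rel_le x y)).trans (hB.1 _ _),
    fun D s hD hs => ?_⟩
  calc B (f s) = ⨆ y, B y ⊓ zadehImage f D y :=
        hB.2 _ _ (hf.rel_le.isDirected_zadehImage hD) (hf D s hD hs)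
    _ = ⨆ x, B (f x) ⊓ D x := iSup_inf_zadehImage f D B

theorem scottContinuous_specializationOrder {τ : LTopology L Q} (h : τ.IsT0)
    (hf : e.scottTopology.ContinuousMap τ f) : e.ScottContinuous (τ.specializationOrder h) f :=
  fun D s hD hs => LTopology.isSup_specializationOrder h fun B hB =>
    ((hf B hB).2 D s hD hs).trans (iSup_inf_zadehImage f D B).symm

theorem IsContinuous.scottContinuous_iff (he' : e'.IsContinuous) :
    e.ScottContinuous e' f ↔ e.scottTopology.ContinuousMap e'.scottTopology f := by
  refine ⟨ScottContinuous.continuousMap_scottTopology, fun hf => ?_⟩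
  simpa only [he'.specializationOrder_scottTopology] using
    scottContinuous_specializationOrder he'.isT0_scottTopology hf

/-! ### The Scott space of a continuous `L`-dcpo -/

theorem IsContinuous.isCoreBasis (he : e.IsContinuous) :
    e.scottTopology.IsCoreBasis id fun z x => e.wayBelow x z where
  isOpen := he.isScottOpen_wayBelow
  apply_eq_iSup _ hA x := hA.2 _ x (he x).1 (he x).2

theorem IsContinuous.isSober_scottTopology (he : e.IsContinuous) (hd : e.IsDcpo) :
    e.scottTopology.IsSober := by
  have horder := he.specializationOrder_scottTopology he.isT0_scottTopology
  refine he.isCoreBasis.isSober he.isT0_scottTopology ?_ fun A hA => ?_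
  · rwa [horder]
  · rwa [horder]

end LOrder

theorem LTopology.IsSober.scottContinuous {L : Type u} [Order.Frame L] {X : Type v} {Y : Type w}
    {τ : LTopology L X} {τ' : LTopology L Y} {f : X → Y} (h : τ.IsSober) (h' : τ'.IsT0)
    (hf : τ.ContinuousMap τ' f) :
    (τ.specializationOrder h.isT0).ScottContinuous (τ'.specializationOrder h') f :=
  LOrder.scottContinuous_specializationOrder h' fun B hB => h.isScottOpen (hf B hB)

/-! ### Recognizing directed completions and `L`-sobrifications -/

section Completions

open LTopology

variable {L : Type u} [Order.Frame L] {P : Type v} {e : LOrder L P}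

theorem isLSobrification_iff {τ : LTopology L P} {Y : LSob.{u, max u v} L} :
    IsLSobrification τ Y ↔ ∃ j, IsQuasiHomeomorphism τ Y.obj.topology j := by
  refine exists_congr fun j => ⟨fun ⟨hj, huniv⟩ => ?_, fun hj =>
    ⟨hj.continuousMap, fun Z f hf => hj.existsUnique_lift Z.property hf⟩⟩
  obtain ⟨h, ⟨hh, hhj⟩, -⟩ := huniv ⟨⟨τ.Point, τ.pointTopology⟩, isSober_pointTopology⟩
    τ.evalPoint isQuasiHomeomorphism_evalPoint.continuousMap
  exact Y.property.isQuasiHomeomorphism hj hh hhj fun g hg hgj =>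
    (huniv Y j hj).unique ⟨hg, hgj⟩ ⟨fun _ hB => hB, rfl⟩

theorem isDirectedCompletion_iff (he : e.IsContinuous) {Q : CDom.{u, max u v} L} :
    IsDirectedCompletion e Q ↔
      ∃ j, IsQuasiHomeomorphism e.scottTopology Q.obj.order.scottTopology j := by
  refine exists_congr fun j => ⟨fun ⟨hj, huniv⟩ => ?_, fun hj =>
    ⟨Q.property.1.scottContinuous_iff.2 hj.continuousMap, fun M f hf => ?_⟩⟩
  · have hsob := isSober_pointTopology (τ := e.scottTopology)
    have hb := isQuasiHomeomorphism_evalPoint.isCoreBasis he.isCoreBasis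
    have hcont := hb.isContinuous_specializationOrder hsob
    obtain ⟨h, ⟨hh, hhj⟩, -⟩ := huniv
      ⟨⟨_, e.scottTopology.pointTopology.specializationOrder hsob.isT0⟩,
        hcont, hsob.isDcpo_specializationOrder⟩ e.scottTopology.evalPoint
      (LOrder.scottContinuous_specializationOrder hsob.isT0
        isQuasiHomeomorphism_evalPoint.continuousMap)
    replace hh := hcont.scottContinuous_iff.1 hh
    rw [hb.scottTopology_specializationOrder hsob] at hh
    exact (Q.property.1.isSober_scottTopology Q.property.2).isQuasiHomeomorphism
      hj.continuousMap_scottTopology hh hhj fun g hg hgj => (huniv Q j hj).unique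
        ⟨Q.property.1.scottContinuous_iff.2 hg, hgj⟩ ⟨LOrder.ScottContinuous.id _, rfl⟩
  · simpa only [M.property.1.scottContinuous_iff] using hj.existsUnique_lift
      (M.property.1.isSober_scottTopology M.property.2) hf.continuousMap_scottTopology

namespace IsLSobrification

variable {Y : LSob.{u, max u v} L}

theorem exists_isCoreBasis (hY : IsLSobrification e.scottTopology Y) (he : e.IsContinuous) :
    ∃ (b : P → Y.obj.carrier) (W : P → Y.obj.carrier → L), Y.obj.topology.IsCoreBasis b W := by
  obtain ⟨j, hj⟩ := isLSobrification_iff.1 hY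
  exact ⟨_, _, hj.isCoreBasis he.isCoreBasis⟩

theorem isLocallySuperCompact (hY : IsLSobrification e.scottTopology Y) (he : e.IsContinuous) :
    Y.obj.topology.IsLocallySuperCompact := by
  obtain ⟨b, W, hb⟩ := hY.exists_isCoreBasis he
  exact hb.isLocallySuperCompact

theorem isContinuous_specializationOrder (hY : IsLSobrification e.scottTopology Y)
    (he : e.IsContinuous) :
    (Y.obj.topology.specializationOrder Y.property.isT0).IsContinuous := by
  obtain ⟨b, W, hb⟩ := hY.exists_isCoreBasis he
  exact hb.isContinuous_specializationOrder Y.property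

theorem scottTopology_specializationOrder (hY : IsLSobrification e.scottTopology Y)
    (he : e.IsContinuous) :
    (Y.obj.topology.specializationOrder Y.property.isT0).scottTopology = Y.obj.topology := by
  obtain ⟨b, W, hb⟩ := hY.exists_isCoreBasis he
  exact hb.scottTopology_specializationOrder Y.property

theorem isDirectedCompletion (hY : IsLSobrification e.scottTopology Y) (he : e.IsContinuous) :
    IsDirectedCompletion e
      ⟨⟨Y.obj.carrier, Y.obj.topology.specializationOrder Y.property.isT0⟩,
        hY.isContinuous_specializationOrder he, Y.property.isDcpo_specializationOrder⟩ := by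
  rw [isDirectedCompletion_iff he, hY.scottTopology_specializationOrder he]
  exact isLSobrification_iff.1 hY

end IsLSobrification

theorem IsDirectedCompletion.isLSobrification {Q : CDom.{u, max u v} L}
    (hQ : IsDirectedCompletion e Q) (he : e.IsContinuous) :
    IsLSobrification e.scottTopology
      ⟨(sigmaL L).obj Q.obj, Q.property.1.isSober_scottTopology Q.property.2⟩ :=
  isLSobrification_iff.2 ((isDirectedCompletion_iff he).1 hQ)

/-! ### The restricted functors -/

/-- The restriction of `Σ_L` to directed completions. -/
def sigmaCompletions (he : e.IsContinuous) :
    DirectedCompletions e ⥤ LSobrifications e.scottTopology :=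
  ObjectProperty.lift _
    (ObjectProperty.lift _ (DirectedCompletions.incl e ⋙ CDom.incl L ⋙ sigmaL L)
      fun Q => Q.obj.property.1.isSober_scottTopology Q.obj.property.2)
    fun Q => Q.property.isLSobrification he

/-- The restriction of `Ω_L` to `L`-sobrifications. -/
def omegaSobrifications (he : e.IsContinuous) :
    LSobrifications e.scottTopology ⥤ DirectedCompletions e where
  obj Y := ⟨⟨⟨Y.obj.obj.carrier, Y.obj.obj.topology.specializationOrder Y.obj.property.isT0⟩,
    Y.property.isContinuous_specializationOrder he, Y.obj.property.isDcpo_specializationOrder⟩,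
    Y.property.isDirectedCompletion he⟩
  map {Y Z} f := ⟨⟨f.hom.hom.toFun,
    Y.obj.property.scottContinuous Z.obj.property.isT0 f.hom.hom.prop⟩⟩

theorem functor_eq_of_comp_ι_eq {C : Type*} [Category* C] {D : Type*} [Category* D]
    {p : ObjectProperty D} {F G : C ⥤ p.FullSubcategory} (h : F ⋙ p.ι = G ⋙ p.ι) : F = G := by
  have lift_congr {F' G' : C ⥤ D} (h' : F' = G') (hF : ∀ X, p (F'.obj X))
      (hG : ∀ X, p (G'.obj X)) : p.lift F' hF = p.lift G' hG := by
    subst h'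
    rfl
  exact lift_congr h (fun X => (F.obj X).property) fun X => (G.obj X).property

theorem LPosScott.hom_heq {A B : Type w} {a a' : LOrder L A} {b b' : LOrder L B} (ha : a = a')
    (hb : b = b') {f : A → B} (hf : a.ScottContinuous b f) (hf' : a'.ScottContinuous b' f) :
    HEq (⟨f, hf⟩ : (⟨A, a⟩ : LPosScott L) ⟶ ⟨B, b⟩)
      (⟨f, hf'⟩ : (⟨A, a'⟩ : LPosScott L) ⟶ ⟨B, b'⟩) := by
  subst ha hb
  rfl

theorem LTopCat.hom_heq {A B : Type w} {a a' : LTopology L A} {b b' : LTopology L B} (ha : a = a')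
    (hb : b = b') {f : A → B} (hf : a.ContinuousMap b f) (hf' : a'.ContinuousMap b' f) :
    HEq (⟨f, hf⟩ : (⟨A, a⟩ : LTopCat L) ⟶ ⟨B, b⟩)
      (⟨f, hf'⟩ : (⟨A, a'⟩ : LTopCat L) ⟶ ⟨B, b'⟩) := by
  subst ha hb
  rfl

theorem sigmaCompletions_comp_omegaSobrifications (he : e.IsContinuous) :
    sigmaCompletions he ⋙ omegaSobrifications he = 𝟭 (DirectedCompletions e) := by
  have order_eq (Q : DirectedCompletions e) :
      Q.obj.obj.order.scottTopology.specializationOrder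
        Q.obj.property.1.isT0_scottTopology = Q.obj.obj.order :=
    Q.obj.property.1.specializationOrder_scottTopology _
  refine functor_eq_of_comp_ι_eq (functor_eq_of_comp_ι_eq (Functor.hext (fun Q => ?_)
    fun Q R f => LPosScott.hom_heq (order_eq Q) (order_eq R) _ f.hom.hom.prop))
  exact congrArg (LPosScott.mk Q.obj.obj.carrier) (order_eq Q)

theorem omegaSobrifications_comp_sigmaCompletions (he : e.IsContinuous) :
    omegaSobrifications he ⋙ sigmaCompletions he = 𝟭 (LSobrifications e.scottTopology) := by
  have topology_eq (Y : LSobrifications e.scottTopology) :=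
    Y.property.scottTopology_specializationOrder he
  refine functor_eq_of_comp_ι_eq (functor_eq_of_comp_ι_eq (Functor.hext (fun Y => ?_)
    fun Y Z f => LTopCat.hom_heq (topology_eq Y) (topology_eq Z) _ f.hom.hom.prop))
  exact congrArg (LTopCat.mk Y.obj.obj.carrier) (topology_eq Y)

end Completions

/-- The functors `Σ_L` and `Ω_L` restrict to mutually inverse functors between the category of
directed completions of a continuous `L`-ordered set and the category of `L`-sobrifications of its
Scott space; moreover all these `L`-sobrifications are locally super-compact. -/
theorem mainTheorem5 {L : Type u} [Order.Frame L] {P : Type v} (e : LOrder L P)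
    (he : e.IsContinuous) :
    (∃ (S : DirectedCompletions e ⥤ LSobrifications e.scottTopology)
       (O : LSobrifications e.scottTopology ⥤ DirectedCompletions e),
      S ⋙ LSobrifications.incl e.scottTopology ⋙ LSob.incl L =
          DirectedCompletions.incl e ⋙ CDom.incl L ⋙ sigmaL L ∧
        O ⋙ DirectedCompletions.incl e ⋙ CDom.incl L ⋙ LPosScott.toMono L =
          LSobrifications.incl e.scottTopology ⋙ LSob.toT0 L ⋙ omegaL L ∧
        S ⋙ O = 𝟭 (DirectedCompletions e) ∧
        O ⋙ S = 𝟭 (LSobrifications e.scottTopology)) ∧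
    ∀ Y : LSobrifications e.scottTopology, Y.obj.obj.topology.IsLocallySuperCompact := by
  refine ⟨⟨sigmaCompletions he, omegaSobrifications he, rfl, rfl,
    sigmaCompletions_comp_omegaSobrifications he, omegaSobrifications_comp_sigmaCompletions he⟩,
    fun Y => Y.property.isLocallySuperCompact he⟩
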